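/- Let $\mathcal H=\mathbb C^2$ and, for $n\ge 1$, let $\mathcal H_+^{\otimes n}\subseteq \mathcal H^{\otimes n}$ be the symmetric subspace, i.e. the set of vectors invariant under all permutations of the $n$ tensor factors. Let $\mathcal D(\mathcal H_+^{\otimes n})$ be the set of density operators (positive semidefinite, trace one) on $\mathcal H_+^{\otimes n}$, regarded as operators on $\mathcal H^{\otimes n}$ supported on $\mathcal H_+^{\otimes n}$. For each spin $j\in\{1,\tfrac32,2,\tfrac52,\dots\}$ let $$\mathcal S_j=\{\rho\in\mathcal D(\mathcal H_+^{\otimes 2}) : \exists\,\omega\in\mathcal D(\mathcal H_+^{\otimes 2j}),\ \operatorname{tr}_{3\dots 2j}(\omega)=\rho\},$$ where $\operatorname{tr}_{3\dots 2j}$ is the partial trace over all qubits but the first two, and let $$\mathcal R=\{\rho\in\mathcal D(\mathcal H_+^{\otimes 2}) : \rho^\Gamma\ge 0\},$$ where $\Gamma$ is the partial transpose with respect to one of the two qubits. A two-qubit state is called separable if it is a convex combination of products $\sigma\otimes\tau$ of one-qubit density matrices. Theorem (Approximating subset). The set $\mathcal R$ is exactly the set of separable states in $\mathcal D(\mathcal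 H_+^{\otimes 2})$, and 1. $\mathcal R\subseteq\mathcal S_j$ for all $j$; 2. $\mathcal S_j\subseteq\mathcal S_{j'}$ whenever $j'\le j$; 3. the set-theoretic limit of $\mathcal S_j$ as $j\to\infty$ exists (the limit superior and the limit inferior agree) and satisfies $\lim_{j\to\infty}\mathcal S_j=\bigcap_j\mathcal S_j\subseteq\mathcal R$. Hence $\lim_{j\to\infty}\mathcal S_j=\bigcap_j\mathcal S_j=\mathcal R$: the extendible sets converge to the set of separable symmetric two-qubit states. -/

import Mathlib

open scoped ComplexOrder

/-- Labels `(i₁, …, iₙ)` of the product basis `|i₁⟩ ⊗ ⋯ ⊗ |iₙ⟩` of the `n`-qubit space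
`(ℂ²)^{⊗ n}`. A vector is a function `QubitBasis n → ℂ` (its coordinates), an operator is a
matrix indexed by `QubitBasis n`. -/
abbrev QubitBasis (n : ℕ) : Type := Fin n → Fin 2

/-- Operators on the `n`-qubit space `(ℂ²)^{⊗ n}`, as matrices in the product basis. -/
abbrev QubitOp (n : ℕ) : Type := Matrix (QubitBasis n) (QubitBasis n) ℂ

/-- The action of `p ∈ Sₙ` on `(ℂ²)^{⊗ n}` which permutes the tensor factors:
`|i₁⟩ ⊗ ⋯ ⊗ |iₙ⟩ ↦ |i_{p⁻¹(1)}⟩ ⊗ ⋯ ⊗ |i_{p⁻¹(n)}⟩`, in coordinates `ψ ↦ (i ↦ ψ (i ∘ p))`. -/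
def permAction {n : ℕ} (p : Equiv.Perm (Fin n)) : (QubitBasis n → ℂ) →ₗ[ℂ] (QubitBasis n → ℂ) where
  toFun ψ := fun i => ψ (i ∘ p)
  map_add' _ _ := rfl
  map_smul' _ _ := rfl

/-- `permAction` on product basis vectors. -/
theorem permAction_single {n : ℕ} (p : Equiv.Perm (Fin n)) (i : QubitBasis n) :
    permAction p (Pi.single i 1) = Pi.single (i ∘ p.symm) 1 := by
  funext x
  have h : x ∘ p = i ↔ x = i ∘ p.symm := by
    constructor
    · rintro rfl
      funext a
      simp
    · rintro rfl
      funext a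
      simp
  simp [permAction, Pi.single_apply, h]

/-- The symmetric subspace of `(ℂ²)^{⊗ n}`: the vectors fixed by all permutations. -/
def symSubspace (n : ℕ) : Submodule ℂ (QubitBasis n → ℂ) where
  carrier := {ψ | ∀ p : Equiv.Perm (Fin n), permAction p ψ = ψ}
  zero_mem' := fun p => map_zero (permAction p)
  add_mem' := fun {a b} ha hb p => by rw [map_add, ha p, hb p]
  smul_mem' := fun c a ha p => by rw [map_smul, ha p]

/-- Density operators on the symmetric subspace of `n` qubits, regarded as operators on
`(ℂ²)^{⊗ n}` supported on that subspace: positive semidefinite, of trace one, and with range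
inside the symmetric subspace (hence, being Hermitian, zero on its orthogonal complement). -/
def symDensity (n : ℕ) : Set (QubitOp n) :=
  {ω | ω.PosSemidef ∧ ω.trace = 1 ∧ ∀ ψ : QubitBasis n → ℂ, ω.mulVec ψ ∈ symSubspace n}

/-- The partial trace over the last `k` of `m + k` qubits. -/
def traceLast (m k : ℕ) (ω : QubitOp (m + k)) : QubitOp m :=
  Matrix.of fun x y => ∑ z : QubitBasis k, ω (Fin.append x z) (Fin.append y z)

/-- The set `S_j` of two-qubit reductions of spin-`j` systems, for the total spin
`j = 1 + k / 2` (so `2 j = 2 + k`; the spins `j = 1, 3/2, 2, …` are `k = 0, 1, 2, …`):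
the symmetric two-qubit states which have an extension to a symmetric state of `2 j` qubits. -/
def spinReductions (k : ℕ) : Set (QubitOp 2) :=
  {ρ | ρ ∈ symDensity 2 ∧ ∃ ω ∈ symDensity (2 + k), traceLast 2 k ω = ρ}

/-- The partial transpose of a two-qubit operator, with respect to the second qubit:
`⟨a b| ρ^Γ |c d⟩ = ⟨a d| ρ |c b⟩`. -/
def partialTranspose (ρ : QubitOp 2) : QubitOp 2 :=
  Matrix.of fun x y => ρ ![x 0, y 1] ![y 0, x 1]

/-- The set `R` of symmetric two-qubit states with positive semidefinite partial transpose. -/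
def pptStates : Set (QubitOp 2) :=
  {ρ | ρ ∈ symDensity 2 ∧ (partialTranspose ρ).PosSemidef}

/-- The tensor product of two one-qubit operators. -/
def qubitTensor (σ τ : Matrix (Fin 2) (Fin 2) ℂ) : QubitOp 2 :=
  Matrix.of fun x y => σ (x 0) (y 0) * τ (x 1) (y 1)

/-- Separable two-qubit states: convex combinations of products `σ ⊗ τ` of density matrices. -/
def separableStates : Set (QubitOp 2) :=
  convexHull ℝ {ρ | ∃ σ τ : Matrix (Fin 2) (Fin 2) ℂ,
    σ.PosSemidef ∧ σ.trace = 1 ∧ τ.PosSemidef ∧ τ.trace = 1 ∧ ρ = qubitTensor σ τ}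

/-! Tracing out one more qubit shows that the extendible sets decrease, so both limits equal their
intersection.

Extendible to all orders implies positive partial transpose: for an extension `ω` to `n` qubits and
`X = ∑ A⁽ⁱ⁾`, `0 ≤ tr (X ω X†) = n (p + (n - 1) q)` by symmetry, where `p` and `q` depend only on
`ρ` and `A`. Letting `n → ∞` gives `q ≥ 0`, and each value of the quadratic form of `ρ^Γ` is such a
`q` (`pairCorrelation_eq_partialTranspose`).

Conversely, read vectors of `ℂ² ⊗ ℂ²` as `2 × 2` matrices. Symmetry of `ρ` makes `ρ^Γ` commute with
`v ↦ v†`, so a positive `ρ^Γ` is a sum of `v v*` over Hermitian `v`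
(`exists_hermForm_decomposition`); symmetry also gives `∑ det v = 0`. Rotating pairs of summands
makes every `det v` vanish (`exists_isotropic_decomposition`), so `v = ± ψψ†` and `ρ = ∑ ψψ† ⊗ ψψ†`.
Such a sum is visibly separable and extendible. -/

/-! ### Partial traces and the decreasing chain of extendible sets -/

/-- Sums over the basis labels of `m + k` qubits, split into the first `m` and the last `k`. -/
theorem sum_append {M : Type*} [AddCommMonoid M] (m k : ℕ) (f : QubitBasis (m + k) → M) :
    ∑ x, f x = ∑ x : QubitBasis m, ∑ z : QubitBasis k, f (Fin.append x z) := by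
  rw [← Fintype.sum_prod_type' (f := fun x z => f (Fin.append x z))]
  exact (Equiv.sum_comp (Fin.appendEquiv m k) f).symm

theorem traceLast_apply (m k : ℕ) (ω : QubitOp (m + k)) (x y : QubitBasis m) :
    traceLast m k ω x y = ∑ z : QubitBasis k, ω (Fin.append x z) (Fin.append y z) := rfl

/-- An operator has range in the symmetric subspace iff its entries are invariant under
permutations of the row label. -/
theorem mulVec_mem_symSubspace_iff {n : ℕ} (ω : QubitOp n) :
    (∀ ψ : QubitBasis n → ℂ, ω.mulVec ψ ∈ symSubspace n) ↔
      ∀ (p : Equiv.Perm (Fin n)) (x y : QubitBasis n), ω (x ∘ p) y = ω x y := by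
  constructor
  · intro h p x y
    have := congrFun (h (Pi.single y 1) p) x
    simpa [permAction] using this
  · intro h ψ p
    funext x
    simp [permAction, Matrix.mulVec, dotProduct, h p x]

theorem symDensity_perm_left {n : ℕ} {ω : QubitOp n} (h : ω ∈ symDensity n)
    (p : Equiv.Perm (Fin n)) (x y : QubitBasis n) : ω (x ∘ p) y = ω x y :=
  (mulVec_mem_symSubspace_iff ω).1 h.2.2 p x y

theorem symDensity_perm_right {n : ℕ} {ω : QubitOp n} (h : ω ∈ symDensity n)
    (p : Equiv.Perm (Fin n)) (x y : QubitBasis n) : ω x (y ∘ p) = ω x y := by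
  rw [← h.1.isHermitian.apply, symDensity_perm_left h, h.1.isHermitian.apply]

theorem trace_traceLast (m k : ℕ) (ω : QubitOp (m + k)) :
    (traceLast m k ω).trace = ω.trace := by
  simp only [Matrix.trace, Matrix.diag, traceLast_apply]
  exact (sum_append m k fun x => ω x x).symm

theorem posSemidef_traceLast {m k : ℕ} {ω : QubitOp (m + k)} (h : ω.PosSemidef) :
    (traceLast m k ω).PosSemidef := by
  have : traceLast m k ω = ∑ z : QubitBasis k,
      ω.submatrix (fun x => Fin.append x z) (fun x => Fin.append x z) := by
    ext x y
    simp [traceLast_apply, Matrix.sum_apply]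
  rw [this]
  exact Matrix.posSemidef_sum _ fun z _ => h.submatrix _

theorem append_comp_perm {m k : ℕ} (p : Equiv.Perm (Fin m)) (x : QubitBasis m)
    (z : QubitBasis k) :
    Fin.append (x ∘ p) z =
      Fin.append x z ∘ (finSumFinEquiv.permCongr (p.sumCongr (Equiv.refl (Fin k)))) := by
  funext i
  refine Fin.addCases (fun i => ?_) (fun i => ?_) i <;> simp [Equiv.permCongr_apply]

theorem traceLast_mem_symDensity {m k : ℕ} {ω : QubitOp (m + k)} (h : ω ∈ symDensity (m + k)) :
    traceLast m k ω ∈ symDensity m := by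
  refine ⟨posSemidef_traceLast h.1, by rw [trace_traceLast, h.2.1], ?_⟩
  rw [mulVec_mem_symSubspace_iff]
  intro p x y
  simp only [traceLast_apply, append_comp_perm, symDensity_perm_left h]

theorem traceLast_traceLast_one (m k : ℕ) (ω : QubitOp (m + (k + 1))) :
    traceLast m k (traceLast (m + k) 1 ω) = traceLast m (k + 1) ω := by
  ext x y
  simp only [traceLast_apply, sum_append k 1]
  refine Finset.sum_congr rfl fun z _ => Finset.sum_congr rfl fun w _ => ?_
  rw [Fin.append_assoc, Fin.append_assoc]
  rfl

theorem spinReductions_antitone : Antitone spinReductions := by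
  refine antitone_nat_of_succ_le fun k => ?_
  rintro ρ ⟨hρ, ω, hω, rfl⟩
  exact ⟨hρ, traceLast (2 + k) 1 ω, traceLast_mem_symDensity (m := 2 + k) (k := 1) hω,
    traceLast_traceLast_one 2 k ω⟩

theorem limsup_spinReductions :
    Filter.limsup spinReductions Filter.atTop = ⋂ k : ℕ, spinReductions k := by
  rw [Filter.limsup_eq_iInf_iSup_of_nat]
  exact iInf_congr fun n =>
    le_antisymm (iSup₂_le fun i hi => spinReductions_antitone hi) (le_iSup₂_of_le n le_rfl le_rfl)

theorem liminf_spinReductions :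
    Filter.liminf spinReductions Filter.atTop = ⋂ k : ℕ, spinReductions k := by
  rw [Filter.liminf_eq_iSup_iInf_of_nat]
  refine le_antisymm (iSup_le fun n => le_iInf fun i => ?_)
    (le_iSup_of_le 0 (le_iInf₂ fun i _ => iInf_le _ i))
  exact (iInf₂_le (max i n) (le_max_right i n)).trans (spinReductions_antitone (le_max_left i n))

/-! ### Extendibility to all orders forces a positive partial transpose -/

theorem exists_perm_map_pair {α : Type*} [DecidableEq α] {a b i j : α} (hab : a ≠ b)
    (hij : i ≠ j) : ∃ p : Equiv.Perm α, p a = i ∧ p b = j := by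
  refine ⟨(Equiv.swap a i).trans (Equiv.swap (Equiv.swap a i b) j), ?_, ?_⟩
  · have h : i ≠ Equiv.swap a i b := fun h => hab <| (Equiv.swap a i).injective <| by
      rw [← h, Equiv.swap_apply_left]
    simp [Equiv.swap_apply_of_ne_of_ne h hij]
  · simp

/-- The expectation `tr (ω A⁽ⁱ⁾ A⁽ʲ⁾†)`, where `A⁽ⁱ⁾` is the one-qubit operator `A` acting on
the `i`-th qubit. -/
def pairCorrelation {n : ℕ} (A : Matrix (Fin 2) (Fin 2) ℂ) (ω : QubitOp n) (i j : Fin n) : ℂ :=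
  ∑ x : QubitBasis n, ∑ c : Fin 2, ∑ d : Fin 2,
    A (x i) c * star (A (x j) d) * ω (Function.update x i c) (Function.update x j d)

theorem sum_pairCorrelation_nonneg {n : ℕ} (A : Matrix (Fin 2) (Fin 2) ℂ) {ω : QubitOp n}
    (h : ω.PosSemidef) : 0 ≤ ∑ i, ∑ j, pairCorrelation A ω i j := by
  have key : ∑ i, ∑ j, pairCorrelation A ω i j = ∑ x : QubitBasis n,
      ∑ i, ∑ c, ∑ j, ∑ d,
        A (x i) c * star (A (x j) d) * ω (Function.update x i c) (Function.update x j d) := by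
    simp only [pairCorrelation]
    rw [Finset.sum_congr rfl fun i _ => Finset.sum_comm, Finset.sum_comm]
    refine Finset.sum_congr rfl fun x _ => Finset.sum_congr rfl fun i _ => ?_
    rw [Finset.sum_comm]
  rw [key]
  refine Finset.sum_nonneg fun x _ => ?_
  -- For fixed `x` the sum is a quadratic form on pairs `(i, c)`; the labels `update x i c` may
  -- repeat, which is harmless for a positive semidefinite submatrix.
  have hp := h.submatrix (fun q : Fin n × Fin 2 => Function.update x q.1 q.2)
  have := hp.dotProduct_mulVec_nonneg (fun q => star (A (x q.1) q.2))
  refine this.trans_eq ?_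
  simp only [dotProduct, Matrix.mulVec, Matrix.submatrix_apply, Pi.star_apply, star_star,
    Fintype.sum_prod_type, Finset.mul_sum]
  refine Finset.sum_congr rfl fun i _ => Finset.sum_congr rfl fun c _ =>
    Finset.sum_congr rfl fun j _ => Finset.sum_congr rfl fun d _ => ?_
  ring

theorem pairCorrelation_perm {n : ℕ} (A : Matrix (Fin 2) (Fin 2) ℂ) {ω : QubitOp n}
    (h : ω ∈ symDensity n) (p : Equiv.Perm (Fin n)) (i j : Fin n) :
    pairCorrelation A ω (p i) (p j) = pairCorrelation A ω i j := by
  have hu : ∀ (x : QubitBasis n) (k : Fin n) (c : Fin 2),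
      Function.update (x ∘ p) k c = Function.update x (p k) c ∘ p := fun x k c => by
    rw [Function.update_comp_equiv]; simp
  simp only [pairCorrelation]
  rw [eq_comm, ← Equiv.sum_comp (p.symm.arrowCongr (Equiv.refl (Fin 2)))]
  refine Finset.sum_congr rfl fun x _ => Finset.sum_congr rfl fun c _ =>
    Finset.sum_congr rfl fun d _ => ?_
  have hx : p.symm.arrowCongr (Equiv.refl (Fin 2)) x = x ∘ p := by
    funext a; simp [Equiv.arrowCongr]
  rw [hx, hu, hu, symDensity_perm_left h, symDensity_perm_right h]
  rfl

theorem update_append_left {m k : ℕ} (x : QubitBasis m) (z : QubitBasis k) (i : Fin m)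
    (c : Fin 2) :
    Function.update (Fin.append x z) (Fin.castAdd k i) c =
      Fin.append (Function.update x i c) z := by
  funext a
  refine Fin.addCases (fun a => ?_) (fun a => ?_) a
  · by_cases h : a = i
    · subst h; simp
    · simp [h]
  · have : Fin.natAdd m a ≠ Fin.castAdd k i := by
      intro h
      have := congrArg Fin.val h
      simp at this
      lia
    simp [this]

theorem pairCorrelation_traceLast {m k : ℕ} (A : Matrix (Fin 2) (Fin 2) ℂ)
    (ω : QubitOp (m + k)) (i j : Fin m) :
    pairCorrelation A ω (Fin.castAdd k i) (Fin.castAdd k j) =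
      pairCorrelation A (traceLast m k ω) i j := by
  simp only [pairCorrelation, sum_append m k, update_append_left, Fin.append_left, traceLast_apply,
    Finset.mul_sum]
  refine Finset.sum_congr rfl fun x _ => ?_
  rw [Finset.sum_comm]
  refine Finset.sum_congr rfl fun c _ => ?_
  rw [Finset.sum_comm]

/-- Permutations act transitively on qubits and on ordered pairs of distinct qubits, so only one
diagonal and one off-diagonal value occur. -/
theorem sum_pairCorrelation_eq {k : ℕ} (A : Matrix (Fin 2) (Fin 2) ℂ) {ω : QubitOp (2 + k)}
    (h : ω ∈ symDensity (2 + k)) :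
    ∑ i, ∑ j, pairCorrelation A ω i j =
      (2 + k : ℂ) * (pairCorrelation A (traceLast 2 k ω) 0 0 +
        (1 + k : ℂ) * pairCorrelation A (traceLast 2 k ω) 0 1) := by
  have h01 : Fin.castAdd k (0 : Fin 2) ≠ Fin.castAdd k (1 : Fin 2) := by
    simp [Fin.ext_iff]
  have hrow : ∀ i : Fin (2 + k), ∑ j, pairCorrelation A ω i j =
      pairCorrelation A (traceLast 2 k ω) 0 0 +
        (1 + k : ℂ) * pairCorrelation A (traceLast 2 k ω) 0 1 := by
    intro i
    rw [← Finset.add_sum_erase _ _ (Finset.mem_univ i)]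
    congr 1
    · have := pairCorrelation_perm A h (Equiv.swap (Fin.castAdd k 0) i)
        (Fin.castAdd k 0) (Fin.castAdd k 0)
      rwa [Equiv.swap_apply_left, pairCorrelation_traceLast] at this
    · rw [Finset.sum_congr rfl (g := fun _ => pairCorrelation A (traceLast 2 k ω) 0 1)]
      · rw [Finset.sum_const, Finset.card_erase_of_mem (Finset.mem_univ i), Finset.card_univ,
          Fintype.card_fin, nsmul_eq_mul, show 2 + k - 1 = 1 + k by lia]
        push_cast
        ring
      · intro j hj
        obtain ⟨p, hp0, hp1⟩ := exists_perm_map_pair h01 (Finset.ne_of_mem_erase hj).symm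
        have := pairCorrelation_perm A h p (Fin.castAdd k 0) (Fin.castAdd k 1)
        rwa [hp0, hp1, pairCorrelation_traceLast] at this
  rw [Finset.sum_congr rfl fun i _ => hrow i, Finset.sum_const, Finset.card_univ,
    Fintype.card_fin, nsmul_eq_mul]
  push_cast
  ring

theorem symDensity_two_swap_left {ρ : QubitOp 2} (h : ρ ∈ symDensity 2) (a b : Fin 2)
    (y : QubitBasis 2) : ρ ![a, b] y = ρ ![b, a] y := by
  rw [← symDensity_perm_left h (Equiv.swap 0 1)]
  congr 1
  funext i
  fin_cases i <;> simp

theorem symDensity_two_swap_right {ρ : QubitOp 2} (h : ρ ∈ symDensity 2) (a b : Fin 2)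
    (x : QubitBasis 2) : ρ x ![a, b] = ρ x ![b, a] := by
  rw [← h.1.isHermitian.apply, symDensity_two_swap_left h, h.1.isHermitian.apply]

theorem sum_qubitBasis_two {M : Type*} [AddCommMonoid M] (f : QubitBasis 2 → M) :
    ∑ x, f x = ∑ a, ∑ b, f ![a, b] := by
  rw [← Fintype.sum_prod_type' (f := fun a b => f ![a, b])]
  exact (Equiv.sum_comp (finTwoArrowEquiv (Fin 2)).symm f).symm

/-- For a symmetric two-qubit state the expectation of `A ⊗ A†` is a value of the quadratic form
of the partial transpose. -/
theorem pairCorrelation_eq_partialTranspose {ρ : QubitOp 2} (h : ρ ∈ symDensity 2)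
    (v : QubitBasis 2 → ℂ) :
    pairCorrelation (Matrix.of fun a c => star (v ![c, a])) ρ 0 1 =
      star v ⬝ᵥ (partialTranspose ρ).mulVec v := by
  have h1 := symDensity_two_swap_left h 1 0
  have h2 := symDensity_two_swap_right h 1 0
  have u0 : ∀ a b c : Fin 2, Function.update ![a, b] 0 c = ![c, b] := by decide
  have u1 : ∀ a b c : Fin 2, Function.update ![a, b] 1 c = ![a, c] := by decide
  simp only [pairCorrelation, dotProduct, Matrix.mulVec, sum_qubitBasis_two, partialTranspose,
    Fin.sum_univ_two, Matrix.of_apply, Pi.star_apply, Matrix.cons_val_zero, Matrix.cons_val_one,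
    u0, u1, star_star, h1, h2]
  ring

theorem isHermitian_partialTranspose {ρ : QubitOp 2} (h : ρ.IsHermitian) :
    (partialTranspose ρ).IsHermitian := by
  ext x y
  exact h.apply _ _

theorem iInter_spinReductions_subset : (⋂ k : ℕ, spinReductions k) ⊆ pptStates := by
  intro ρ hρ
  rw [Set.mem_iInter] at hρ
  have hs : ρ ∈ symDensity 2 := (hρ 0).1
  refine ⟨hs, Matrix.PosSemidef.of_dotProduct_mulVec_nonneg
    (isHermitian_partialTranspose hs.1.isHermitian) fun v => ?_⟩
  rw [← pairCorrelation_eq_partialTranspose hs]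
  set A : Matrix (Fin 2) (Fin 2) ℂ := Matrix.of fun a c => star (v ![c, a])
  set p := pairCorrelation A ρ 0 0
  set q := pairCorrelation A ρ 0 1
  have key : ∀ k : ℕ, 0 ≤ p + (1 + k : ℂ) * q := by
    intro k
    obtain ⟨-, ω, hω, rfl⟩ := hρ k
    have := sum_pairCorrelation_nonneg A hω.1
    rw [sum_pairCorrelation_eq A hω] at this
    have h2 : (0 : ℂ) < 2 + k := by exact_mod_cast (by lia : 0 < 2 + k)
    have h3 := mul_nonneg (RCLike.inv_pos_of_pos h2).le this
    rwa [inv_mul_cancel_left₀ h2.ne'] at h3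
  -- The cases `k = 0, 1` give `p.im + q.im = 0` and `p.im + 2 q.im = 0`.
  have him : q.im = 0 := by
    have h0 := (Complex.le_def.1 (key 0)).2
    have h1 := (Complex.le_def.1 (key 1)).2
    simp at h0 h1
    linarith
  refine Complex.le_def.2 ⟨?_, him.symm⟩
  by_contra! hq
  rw [Complex.zero_re] at hq
  obtain ⟨k, hk⟩ := exists_nat_gt (p.re / -q.re)
  have hk' := (Complex.le_def.1 (key k)).1
  simp [him] at hk'
  rw [div_lt_iff₀ (by linarith)] at hk
  nlinarith

/-! ### Rotating a sum of squares into isotropic vectors -/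

/-- The form is continuous along the quarter circle from `x` to `y` and changes sign. -/
theorem exists_rotation_isotropic {V : Type*} [AddCommGroup V] [Module ℝ V]
    (q : V →ₗ[ℝ] V →ₗ[ℝ] ℝ) {x y : V} (hx : 0 < q x x) (hy : q y y < 0) :
    ∃ c s : ℝ, c ^ 2 + s ^ 2 = 1 ∧ q (c • x + s • y) (c • x + s • y) = 0 := by
  have hcont : ContinuousOn (fun t : ℝ => q (Real.cos t • x + Real.sin t • y)
      (Real.cos t • x + Real.sin t • y)) (Set.Icc 0 (Real.pi / 2)) := by
    simp only [map_add, map_smul, LinearMap.add_apply, LinearMap.smul_apply, smul_eq_mul]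
    fun_prop
  have := intermediate_value_Icc' (by positivity) hcont
  obtain ⟨t, -, ht⟩ := this (show (0 : ℝ) ∈ _ by simp [hx.le, hy.le])
  exact ⟨Real.cos t, Real.sin t, by rw [add_comm, Real.sin_sq_add_cos_sq], ht⟩

/-- A finite sum of squares on which the form `q` vanishes in total is also a sum of squares of
`q`-isotropic vectors. -/
theorem exists_isotropic_decomposition {V : Type*} [AddCommGroup V] [Module ℝ V]
    (q : V →ₗ[ℝ] V →ₗ[ℝ] ℝ) (n : ℕ) (s : Multiset V) (hn : s.card = n)
    (hs : (s.map fun v => q v v).sum = 0) :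
    ∃ t : Multiset V, (∀ v ∈ t, q v v = 0) ∧
      ∀ B : V →ₗ[ℝ] V →ₗ[ℝ] ℂ, (t.map fun v => B v v).sum = (s.map fun v => B v v).sum := by
  induction n generalizing s with
  | zero =>
    rw [Multiset.card_eq_zero] at hn
    exact ⟨0, by simp, by simp [hn]⟩
  | succ n ih =>
    by_cases hall : ∀ v ∈ s, q v v = 0
    · exact ⟨s, hall, fun _ => rfl⟩
    have hpos : ∃ x ∈ s, 0 < q x x := by
      by_contra! hle
      refine hall fun v hv => ?_
      have h0 : ∀ a ∈ s.map fun v => -q v v, 0 ≤ a := by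
        simp only [Multiset.mem_map]
        rintro a ⟨w, hw, rfl⟩
        linarith [hle w hw]
      have h1 := Multiset.all_zero_of_le_zero_le_of_sum_eq_zero h0
        (by rw [Multiset.sum_map_neg, hs, neg_zero]) _ (Multiset.mem_map_of_mem _ hv)
      simpa using h1
    have hneg : ∃ x ∈ s, q x x < 0 := by
      by_contra! hle
      refine hall fun v hv => ?_
      have h0 : ∀ a ∈ s.map fun v => q v v, 0 ≤ a := by
        simp only [Multiset.mem_map]
        rintro a ⟨w, hw, rfl⟩
        exact hle w hw
      exact Multiset.all_zero_of_le_zero_le_of_sum_eq_zero h0 hs _ (Multiset.mem_map_of_mem _ hv)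
    obtain ⟨x, hxs, hx⟩ := hpos
    obtain ⟨y, hys, hy⟩ := hneg
    obtain ⟨s, rfl⟩ := Multiset.exists_cons_of_mem hxs
    have hyx : y ≠ x := by rintro rfl; linarith
    obtain ⟨s, rfl⟩ := Multiset.exists_cons_of_mem ((Multiset.mem_cons.1 hys).resolve_left hyx)
    obtain ⟨c, d, hcd, hq⟩ := exists_rotation_isotropic q hx hy
    -- A rotation preserves `x ⊗ x + y ⊗ y`. The target `W` is arbitrary because this is used both
    -- for the real form `q` and for the complex forms `B`.
    have hrot : ∀ {W : Type} [AddCommGroup W] [Module ℝ W] (B : V →ₗ[ℝ] V →ₗ[ℝ] W),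
        B (c • x + d • y) (c • x + d • y) + B (-d • x + c • y) (-d • x + c • y) =
          B x x + B y y := by
      intro W _ _ B
      have : ∀ w : W, w = (c ^ 2 + d ^ 2) • w := fun w => by rw [hcd, one_smul]
      rw [this (B x x), this (B y y)]
      simp only [map_add, map_smul, LinearMap.add_apply, LinearMap.smul_apply]
      module
    -- The isotropic rotated vector is split off; its partner returns to the multiset, which is now
    -- one shorter and still has total zero.
    obtain ⟨t, ht, htB⟩ := ih ((-d • x + c • y) ::ₘ s) (by simpa using hn) (by
      have h1 := hrot q
      rw [hq, zero_add] at h1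
      simp only [Multiset.map_cons, Multiset.sum_cons] at hs ⊢
      rw [h1, ← hs]
      ring)
    refine ⟨(c • x + d • y) ::ₘ t, ?_, fun B => ?_⟩
    · exact Multiset.forall_mem_cons.2 ⟨hq, ht⟩
    · simp only [Multiset.map_cons, Multiset.sum_cons, htB]
      rw [← add_assoc, hrot B, add_assoc]

/-! ### Hermitian matrices and the determinant form -/

/-- The entries of the Hermitian `2 × 2` matrix with diagonal `a, b` and upper entry `c`, as
linear functions of `(a, b, c)`. -/
noncomputable def hermEntry (i j : Fin 2) : ℝ × ℝ × ℂ →ₗ[ℝ] ℂ :=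
  !![Complex.ofRealCLM.toLinearMap ∘ₗ LinearMap.fst ℝ ℝ (ℝ × ℂ),
      LinearMap.snd ℝ ℝ ℂ ∘ₗ LinearMap.snd ℝ ℝ (ℝ × ℂ);
    Complex.conjAe.toLinearMap ∘ₗ LinearMap.snd ℝ ℝ ℂ ∘ₗ LinearMap.snd ℝ ℝ (ℝ × ℂ),
      Complex.ofRealCLM.toLinearMap ∘ₗ LinearMap.fst ℝ ℝ ℂ ∘ₗ LinearMap.snd ℝ ℝ (ℝ × ℂ)] i j

theorem hermEntry_apply (i j : Fin 2) (v : ℝ × ℝ × ℂ) :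
    hermEntry i j v = !![(v.1 : ℂ), v.2.2; star v.2.2, (v.2.1 : ℂ)] i j := by
  fin_cases i <;> fin_cases j <;> simp [hermEntry]

/-- The form `(v, w) ↦ v_{ab} conj w_{cd}` on Hermitian matrices. -/
noncomputable def hermForm (a b c d : Fin 2) : ℝ × ℝ × ℂ →ₗ[ℝ] ℝ × ℝ × ℂ →ₗ[ℝ] ℂ :=
  (LinearMap.mul ℝ ℂ).compl₁₂ (hermEntry a b) (Complex.conjAe.toLinearMap ∘ₗ hermEntry c d)

theorem hermForm_apply (a b c d : Fin 2) (v w : ℝ × ℝ × ℂ) :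
    hermForm a b c d v w = hermEntry a b v * star (hermEntry c d w) := by
  simp [hermForm]

/-- The form polarizing the determinant of Hermitian matrices. -/
noncomputable def hermDet : ℝ × ℝ × ℂ →ₗ[ℝ] ℝ × ℝ × ℂ →ₗ[ℝ] ℝ :=
  (hermForm 0 0 1 1 - hermForm 0 1 0 1).compr₂ Complex.reLm

theorem hermDet_apply (v : ℝ × ℝ × ℂ) :
    hermDet v v = v.1 * v.2.1 - Complex.normSq v.2.2 := by
  simp [hermDet, hermForm_apply, hermEntry_apply, Complex.normSq_apply]

/-- A singular Hermitian `2 × 2` matrix is `± ψψ†`. -/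
theorem exists_vector_of_hermDet_eq_zero {v : ℝ × ℝ × ℂ} (h : hermDet v v = 0) :
    ∃ ψ : Fin 2 → ℂ, ∀ a b c d,
      hermForm a b c d v v = ψ a * star (ψ b) * star (ψ c) * ψ d := by
  suffices hpos : ∀ a b : ℝ, ∀ c : ℂ, 0 ≤ a → 0 ≤ b → a * b = Complex.normSq c →
      ∃ ψ : Fin 2 → ℂ, ∀ i j, hermEntry i j (a, b, c) = ψ i * star (ψ j) by
    obtain ⟨a, b, c⟩ := v
    rw [hermDet_apply, sub_eq_zero] at h
    simp only at h
    have hab : 0 ≤ a * b := h ▸ Complex.normSq_nonneg c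
    rcases mul_nonneg_iff.1 hab with ⟨ha, hb⟩ | ⟨ha, hb⟩
    · obtain ⟨ψ, hψ⟩ := hpos a b c ha hb h
      refine ⟨ψ, fun i j k l => ?_⟩
      rw [hermForm_apply, hψ, hψ, star_mul, star_star]
      ring
    -- The sign of `-ψψ†` cancels, since `hermForm` is quadratic on the diagonal.
    · obtain ⟨ψ, hψ⟩ := hpos (-a) (-b) (-c) (by linarith) (by linarith) (by simpa using h)
      refine ⟨ψ, fun i j k l => ?_⟩
      have hn : ∀ i j, hermEntry i j (a, b, c) = -(ψ i * star (ψ j)) := fun i j => by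
        rw [← hψ, ← map_neg]
        simp
      rw [hermForm_apply, hn, hn, star_neg, star_mul, star_star]
      ring
  intro a b c ha hb hc
  rcases ha.eq_or_lt with rfl | ha
  · have hc0 : c = 0 := by simpa using hc.symm
    refine ⟨![0, (Real.sqrt b : ℂ)], fun i j => ?_⟩
    have hb2 : (Real.sqrt b : ℂ) * Real.sqrt b = b := by exact_mod_cast Real.mul_self_sqrt hb
    fin_cases i <;> fin_cases j <;> simp [hermEntry_apply, hc0, hb2]
  · have ha2 : (Real.sqrt a : ℂ) * Real.sqrt a = a := by exact_mod_cast Real.mul_self_sqrt ha.le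
    have hne : (Real.sqrt a : ℂ) ≠ 0 := by exact_mod_cast (Real.sqrt_pos.2 ha).ne'
    have hbc : (a : ℂ) * b = star c * c := by
      rw [← Complex.ofReal_mul, hc]
      exact Complex.normSq_eq_conj_mul_self
    refine ⟨![(Real.sqrt a : ℂ), star c / Real.sqrt a], fun i j => ?_⟩
    fin_cases i <;> fin_cases j <;> simp [hermEntry_apply, ha2] <;> field_simp
    · rw [sq, ha2, mul_comm]; exact hbc

/-- The matrix `(v + v†) / 2`, for `v` read as a `2 × 2` matrix. -/
noncomputable def hermPart (v : QubitBasis 2 → ℂ) : ℝ × ℝ × ℂ :=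
  ((v ![0, 0]).re, (v ![1, 1]).re, (v ![0, 1] + star (v ![1, 0])) / 2)

theorem hermEntry_hermPart (v : QubitBasis 2 → ℂ) (a b : Fin 2) :
    hermEntry a b (hermPart v) = (v ![a, b] + star (v ![b, a])) / 2 := by
  rw [hermEntry_apply, hermPart]
  fin_cases a <;> fin_cases b <;> simp [Complex.re_eq_add_conj, add_comm]

/-- A vector `v` and its adjoint `v†` together are equivalent to the two Hermitian matrices
`(v + v†) / 2` and `(v - v†) / 2i`. -/
theorem hermForm_hermPart_add (v : QubitBasis 2 → ℂ) (a b c d : Fin 2) :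
    hermForm a b c d (hermPart v) (hermPart v) +
      hermForm a b c d (hermPart (-Complex.I • v)) (hermPart (-Complex.I • v)) =
    (v ![a, b] * star (v ![c, d]) + star (v ![b, a]) * v ![d, c]) / 2 := by
  have hI : Complex.I ^ 2 = -1 := Complex.I_sq
  simp only [hermForm_apply, hermEntry_hermPart, Pi.smul_apply, smul_eq_mul, star_mul, star_neg,
    star_div₀, star_add, Complex.star_def, Complex.conj_I, Complex.conj_conj, map_ofNat]
  ring_nf
  simp only [hI]
  ring

/-! ### Positive partial transpose gives a sum of product operators -/

/-- The (unnormalized) pure product operator `(ψψ†)^{⊗ n}`. -/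
def productOp (n : ℕ) (ψ : Fin 2 → ℂ) : QubitOp n :=
  Matrix.vecMulVec (fun x => ∏ i, ψ (x i)) (star fun x => ∏ i, ψ (x i))

theorem productOp_two_apply (ψ : Fin 2 → ℂ) (x y : QubitBasis 2) :
    productOp 2 ψ x y = ψ (x 0) * ψ (x 1) * (star (ψ (y 0)) * star (ψ (y 1))) := by
  simp [productOp, Matrix.vecMulVec_apply, Fin.prod_univ_two]

/-- This is the invariance of `ρ^Γ` under the antilinear involution `v ↦ v†`, combining hermiticity
with the swap symmetry on both sides. -/
theorem partialTranspose_adjoint {ρ : QubitOp 2} (h : ρ ∈ symDensity 2) (a b c d : Fin 2) :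
    partialTranspose ρ ![a, b] ![c, d] = star (partialTranspose ρ ![b, a] ![d, c]) := by
  simp only [partialTranspose, Matrix.of_apply, Matrix.cons_val_zero, Matrix.cons_val_one]
  rw [h.1.isHermitian.apply, symDensity_two_swap_left h, symDensity_two_swap_right h]

-- A factorization `B* B` writes `ρ^Γ` as a sum of `v v*`. By invariance the adjoints `v†` give the
-- same sum, and averaging the two leaves only Hermitian vectors.
open scoped MatrixOrder in
theorem exists_hermForm_decomposition {ρ : QubitOp 2} (h : ρ ∈ pptStates) :
    ∃ s : Multiset (ℝ × ℝ × ℂ), ∀ a b c d : Fin 2,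
      partialTranspose ρ ![a, b] ![c, d] = (s.map fun v => hermForm a b c d v v).sum := by
  obtain ⟨B, hB⟩ := CStarAlgebra.nonneg_iff_eq_star_mul_self.1 h.2.nonneg
  have hM : ∀ x y, partialTranspose ρ x y = ∑ k, star (B k x) * B k y := fun x y => by
    rw [hB]; rfl
  let v : QubitBasis 2 → QubitBasis 2 → ℂ := fun k x => star (B k x)
  refine ⟨Finset.univ.val.map (fun k => hermPart (v k)) +
    Finset.univ.val.map (fun k => hermPart (-Complex.I • v k)), fun a b c d => ?_⟩
  rw [Multiset.map_add, Multiset.sum_add, Multiset.map_map, Multiset.map_map]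
  change _ = ∑ k, hermForm a b c d (hermPart (v k)) (hermPart (v k)) +
    ∑ k, hermForm a b c d (hermPart (-Complex.I • v k)) (hermPart (-Complex.I • v k))
  rw [← Finset.sum_add_distrib, Finset.sum_congr rfl fun k _ => hermForm_hermPart_add (v k) a b c d,
    ← Finset.sum_div, Finset.sum_add_distrib]
  have h1 := hM ![a, b] ![c, d]
  have h2 := partialTranspose_adjoint h.1 a b c d
  rw [hM ![b, a], star_sum] at h2
  simp only [star_mul, star_star] at h2
  rw [eq_div_iff two_ne_zero, mul_two]
  congr 1
  · rw [h1]; exact Finset.sum_congr rfl fun k _ => by simp [v]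
  · rw [h2]; exact Finset.sum_congr rfl fun k _ => by simp [v, mul_comm]

/-- A symmetric two-qubit state with positive partial transpose is a sum of operators
`ψψ† ⊗ ψψ†`. -/
theorem exists_productOp_decomposition {ρ : QubitOp 2} (h : ρ ∈ pptStates) :
    ∃ (n : ℕ) (ψ : Fin n → Fin 2 → ℂ), ρ = ∑ i, productOp 2 (ψ i) := by
  obtain ⟨s, hs⟩ := exists_hermForm_decomposition h
  -- The total determinant is `ρ^Γ` at `(00, 11)` minus `ρ^Γ` at `(01, 01)`, that is `⟨01|ρ|10⟩ -
  -- ⟨01|ρ|01⟩`, which is zero by symmetry.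
  have hdet : (s.map fun v => hermDet v v).sum = 0 := by
    have h1 : (s.map fun v => hermDet v v).sum =
        Complex.reLm (s.map fun v => hermForm 0 0 1 1 v v - hermForm 0 1 0 1 v v).sum := by
      rw [map_multiset_sum, Multiset.map_map]
      rfl
    rw [h1, Multiset.sum_map_sub, ← hs, ← hs]
    simp [partialTranspose, symDensity_two_swap_right h.1 1 0]
  obtain ⟨t, ht, htB⟩ := exists_isotropic_decomposition hermDet _ s rfl hdet
  obtain ⟨l, rfl⟩ := Quot.exists_rep t
  choose! ψ hψ using fun v : ℝ × ℝ × ℂ => exists_vector_of_hermDet_eq_zero (v := v)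
  refine ⟨l.length, fun i => ψ l[i], ?_⟩
  ext x y
  have h0 : ρ x y = partialTranspose ρ ![x 0, y 1] ![y 0, x 1] := by
    simp only [partialTranspose, Matrix.of_apply, Matrix.cons_val_zero, Matrix.cons_val_one]
    congr 1 <;> funext i <;> fin_cases i <;> rfl
  rw [h0, hs, ← htB, Matrix.sum_apply]
  change (List.map _ l).sum = _
  rw [← Fin.sum_univ_fun_getElem]
  refine Finset.sum_congr rfl fun i _ => ?_
  rw [hψ _ (ht _ (List.getElem_mem _)), productOp_two_apply]
  simp only [Fin.getElem_fin]
  ring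

/-! ### Extending and separating sums of product operators -/

theorem posSemidef_productOp (n : ℕ) (ψ : Fin 2 → ℂ) : (productOp n ψ).PosSemidef :=
  Matrix.posSemidef_vecMulVec_self_star _

theorem productOp_perm_left {n : ℕ} (ψ : Fin 2 → ℂ) (p : Equiv.Perm (Fin n))
    (x y : QubitBasis n) : productOp n ψ (x ∘ p) y = productOp n ψ x y := by
  simp only [productOp, Matrix.vecMulVec_apply, Function.comp_apply]
  rw [Equiv.prod_comp p fun i => ψ (x i)]

/-- The squared norm of a one-qubit vector. -/
def vecNormSq (ψ : Fin 2 → ℂ) : ℝ := Complex.normSq (ψ 0) + Complex.normSq (ψ 1)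

theorem vecNormSq_nonneg (ψ : Fin 2 → ℂ) : 0 ≤ vecNormSq ψ :=
  add_nonneg (Complex.normSq_nonneg _) (Complex.normSq_nonneg _)

theorem eq_zero_of_vecNormSq_eq_zero {ψ : Fin 2 → ℂ} (h : vecNormSq ψ = 0) : ψ = 0 := by
  have h0 := Complex.normSq_nonneg (ψ 0)
  have h1 := Complex.normSq_nonneg (ψ 1)
  rw [vecNormSq] at h
  funext i
  fin_cases i
  · exact Complex.normSq_eq_zero.1 (by linarith : Complex.normSq (ψ 0) = 0)
  · exact Complex.normSq_eq_zero.1 (by linarith : Complex.normSq (ψ 1) = 0)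

theorem sum_mul_star_eq_vecNormSq (ψ : Fin 2 → ℂ) :
    ∑ a, ψ a * star (ψ a) = (vecNormSq ψ : ℂ) := by
  simp [vecNormSq, Complex.mul_conj]

theorem trace_productOp (n : ℕ) (ψ : Fin 2 → ℂ) :
    (productOp n ψ).trace = (vecNormSq ψ : ℂ) ^ n := by
  have h : ∀ x : QubitBasis n, productOp n ψ x x = ∏ i, ψ (x i) * star (ψ (x i)) := fun x => by
    simp [productOp, Matrix.vecMulVec_apply, Finset.prod_mul_distrib]
  simp only [Matrix.trace, Matrix.diag, h]
  rw [← Fintype.prod_sum fun (_ : Fin n) a => ψ a * star (ψ a)]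
  simp only [sum_mul_star_eq_vecNormSq, Finset.prod_const, Finset.card_univ, Fintype.card_fin]

theorem productOp_append (m k : ℕ) (ψ : Fin 2 → ℂ) (x y : QubitBasis m) (z w : QubitBasis k) :
    productOp (m + k) ψ (Fin.append x z) (Fin.append y w) =
      productOp m ψ x y * productOp k ψ z w := by
  simp only [productOp, Matrix.vecMulVec_apply, Pi.star_apply, Fin.prod_univ_add, Fin.append_left,
    Fin.append_right, star_mul]
  ring

theorem traceLast_productOp (m k : ℕ) (ψ : Fin 2 → ℂ) :
    traceLast m k (productOp (m + k) ψ) = ((vecNormSq ψ : ℂ) ^ k) • productOp m ψ := by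
  ext x y
  simp only [traceLast_apply, productOp_append, ← Finset.mul_sum, Matrix.smul_apply, smul_eq_mul,
    ← trace_productOp]
  rw [mul_comm]
  rfl

theorem pptStates_subset_spinReductions (k : ℕ) : pptStates ⊆ spinReductions k := by
  intro ρ hρ
  obtain ⟨n, ψ, hψ⟩ := exists_productOp_decomposition hρ
  -- Tracing out `k` qubits multiplies a term by `‖ψ‖ ^ (2k)`, hence the weights; for `ψ = 0` the
  -- term is zero anyway.
  let ω : QubitOp (2 + k) :=
    ∑ i, ((vecNormSq (ψ i) : ℂ) ^ k)⁻¹ • productOp (2 + k) (ψ i)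
  have htr : traceLast 2 k ω = ρ := by
    have hlin : traceLast 2 k ω = ∑ i, ((vecNormSq (ψ i) : ℂ) ^ k)⁻¹ •
        traceLast 2 k (productOp (2 + k) (ψ i)) := by
      ext x y
      simp only [ω, traceLast_apply, Matrix.sum_apply, Matrix.smul_apply, Finset.smul_sum]
      exact Finset.sum_comm
    rw [hlin, hψ]
    refine Finset.sum_congr rfl fun i _ => ?_
    rw [traceLast_productOp, smul_smul]
    by_cases h : vecNormSq (ψ i) = 0
    · have h0 : productOp 2 (ψ i) = 0 := by
        ext x y
        rw [productOp_two_apply, eq_zero_of_vecNormSq_eq_zero h]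
        simp
      rw [h0, smul_zero]
    · rw [inv_mul_cancel₀ (pow_ne_zero _ (by exact_mod_cast h)), one_smul]
  refine ⟨hρ.1, ω, ⟨?_, ?_, ?_⟩, htr⟩
  · refine Matrix.posSemidef_sum _ fun i _ => (posSemidef_productOp _ _).smul ?_
    rw [← Complex.ofReal_pow, ← Complex.ofReal_inv]
    exact Complex.zero_le_real.2 (inv_nonneg.2 (pow_nonneg (vecNormSq_nonneg _) _))
  · rw [← trace_traceLast 2 k, htr, hρ.1.2.1]
  · rw [mulVec_mem_symSubspace_iff]
    intro p x y
    simp only [ω, Matrix.sum_apply, Matrix.smul_apply, productOp_perm_left]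

/-- The product pure states of two qubits, up to normalization, are products of states. -/
theorem productOp_two_eq_smul_qubitTensor (ψ : Fin 2 → ℂ) :
    ∃ σ : Matrix (Fin 2) (Fin 2) ℂ, σ.PosSemidef ∧ σ.trace = 1 ∧
      productOp 2 ψ = (vecNormSq ψ ^ 2) • qubitTensor σ σ := by
  by_cases h : vecNormSq ψ = 0
  -- The coefficient is zero here, so any state serves as `σ`.
  · refine ⟨Matrix.vecMulVec (Pi.single 0 1) (star (Pi.single 0 1)),
      Matrix.posSemidef_vecMulVec_self_star _, ?_, ?_⟩
    · simp [Matrix.trace, Matrix.vecMulVec_apply]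
    · ext x y
      rw [productOp_two_apply, eq_zero_of_vecNormSq_eq_zero h]
      simp [vecNormSq]
  · have hc : (vecNormSq ψ : ℂ) ≠ 0 := by exact_mod_cast h
    refine ⟨((vecNormSq ψ)⁻¹ : ℂ) • Matrix.vecMulVec ψ (star ψ),
      (Matrix.posSemidef_vecMulVec_self_star _).smul ?_, ?_, ?_⟩
    · rw [← Complex.ofReal_inv]
      exact Complex.zero_le_real.2 (inv_nonneg.2 (vecNormSq_nonneg _))
    · rw [Matrix.trace_smul, smul_eq_mul, Matrix.trace]
      simp only [Matrix.diag, Matrix.vecMulVec_apply, Pi.star_apply]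
      rw [sum_mul_star_eq_vecNormSq, inv_mul_cancel₀ hc]
    · ext x y
      rw [productOp_two_apply]
      simp only [qubitTensor, Matrix.smul_apply, Matrix.of_apply, Matrix.vecMulVec_apply,
        Pi.star_apply, smul_eq_mul, Complex.real_smul, Complex.ofReal_pow]
      field_simp

theorem pptStates_subset_separableStates : pptStates ⊆ separableStates := by
  intro ρ hρ
  obtain ⟨n, ψ, hψ⟩ := exists_productOp_decomposition hρ
  choose σ hpos htr hσ using fun i => productOp_two_eq_smul_qubitTensor (ψ i)
  -- The convex weights sum to one because `ρ` has trace one.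
  have hone : ∑ i, vecNormSq (ψ i) ^ 2 = 1 := by
    have := hρ.1.2.1
    rw [hψ, Matrix.trace_sum] at this
    simp only [trace_productOp] at this
    exact_mod_cast this
  rw [hψ, Finset.sum_congr rfl fun i _ => hσ i]
  exact (convex_convexHull ℝ _).sum_mem (fun i _ => sq_nonneg _) hone fun i _ =>
    subset_convexHull ℝ _ ⟨σ i, σ i, hpos i, htr i, hpos i, htr i, rfl⟩

theorem posSemidef_qubitTensor {σ τ : Matrix (Fin 2) (Fin 2) ℂ} (hσ : σ.PosSemidef)
    (hτ : τ.PosSemidef) : (qubitTensor σ τ).PosSemidef :=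
  (hσ.kronecker hτ).submatrix fun x : QubitBasis 2 => (x 0, x 1)

theorem partialTranspose_qubitTensor (σ τ : Matrix (Fin 2) (Fin 2) ℂ) :
    partialTranspose (qubitTensor σ τ) = qubitTensor σ τ.transpose := by
  ext x y
  simp [partialTranspose, qubitTensor]

/-- The condition is convex, and on products `σ ⊗ τ` becomes `σ ⊗ τᵀ`, which is still positive. -/
theorem posSemidef_partialTranspose_of_separable {ρ : QubitOp 2} (h : ρ ∈ separableStates) :
    (partialTranspose ρ).PosSemidef := by
  have hconv : Convex ℝ {ρ : QubitOp 2 | (partialTranspose ρ).PosSemidef} := by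
    intro ρ₁ h₁ ρ₂ h₂ a b ha hb _
    exact (Matrix.PosSemidef.smul h₁ ha).add (Matrix.PosSemidef.smul h₂ hb)
  refine convexHull_min ?_ hconv h
  rintro _ ⟨σ, τ, hσ, -, hτ, -, rfl⟩
  rw [Set.mem_ofPred_eq, partialTranspose_qubitTensor]
  exact posSemidef_qubitTensor hσ hτ.transpose

theorem pptStates_eq : pptStates = symDensity 2 ∩ separableStates :=
  Set.Subset.antisymm (fun _ h => ⟨h.1, pptStates_subset_separableStates h⟩)
    fun _ h => ⟨h.1, posSemidef_partialTranspose_of_separable h.2⟩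

theorem mainTheorem3 :
    pptStates = symDensity 2 ∩ separableStates ∧
    (∀ k : ℕ, pptStates ⊆ spinReductions k) ∧
    (∀ k k' : ℕ, k' ≤ k → spinReductions k ⊆ spinReductions k') ∧
    Filter.limsup spinReductions Filter.atTop = ⋂ k : ℕ, spinReductions k ∧
    Filter.liminf spinReductions Filter.atTop = ⋂ k : ℕ, spinReductions k ∧
    (⋂ k : ℕ, spinReductions k) ⊆ pptStates :=
  ⟨pptStates_eq, pptStates_subset_spinReductions, fun _ _ h => spinReductions_antitone h,
    limsup_spinReductions, liminf_spinReductions, iInter_spinReductions_subset⟩
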